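/- \textbf{Setting.} Let $I$ be a finite set of students, $S$ a finite set of schools and $M$ a finite set of student types; student $i$ has type $\tau(i)\in M$, and $I^m=\tau^{-1}(m)$. School $s$ has $q_s$ seats, of which $q_s^m\in\mathbb N\cup\{0\}$ are reserved for students of type $m$, with $\sum_{m}q_s^m<q_s$ and $q_s^m<|I^m|$. Student $i$ has a score $\pi_{i,s}\in\mathbb N\cup\{0\}$ at $s$; scores of distinct students at $s$ are distinct, and a higher score means a higher priority. Each student $i$ has a strict linear preference order $P_i$ on $S\cup\{\emptyset\}$, where $\emptyset$ is the null school (being unmatched); $R_i$ is the weak preference. A school $s$ is acceptable to $i$ if $s\,P_i\,\emptyset$. \textbf{Matchings.} An \emph{augmented matching} $\mu$ gives each student either $\emptyset$ or a seat of type $t_i^\mu\in\{r,o\}$ (reserved or open) at one school $\mu(i)$, such that each school $s$ admits at most $q_s$ students, of whom, for each $m$, at most $q_s^m$ students of type $m$ have reserved seats. The seat type of an unmatched student is irrelevant and not recorded. The induced \emph{standard matching} is $i\mapsto\mu(i)$. Write $\mu(s)$, $\mu^{o}(s)$ and $\mu^{rm}(s)$ for the students admitted to $s$, those of them in open seats,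 and those of type $m$ in reserved seats. The \emph{cutoffs} of $\mu$ at $s$ are: $c_s^m=+\infty$ if $q_s^m=0$; $c_s^m=\min_{i\in\mu^{rm}(s)}\pi_{i,s}$ if $|\mu^{rm}(s)|=q_s^m>0$; $c_s^m=0$ if $|\mu^{rm}(s)|<q_s^m$; and $c_s^o=\min_{i\in\mu^o(s)}\pi_{i,s}$ if $|\mu(s)|=q_s$, $c_s^o=0$ otherwise. A school $s$ is \emph{affordable} to $i$ if $\pi_{i,s}\ge\min\{c_s^{\tau(i)},c_s^o\}$; the null school is affordable to everyone. Given the preferences, $\mu$ is \emph{RO-verifiable} (\emph{OR-verifiable}) if, for every student $i$, $\mu(i)$ is her most preferred affordable school and, if $\mu(i)=s\neq\emptyset$, then $t_i^\mu=r$ if and only if $\pi_{i,s}\ge c_s^{\tau(i)}$ (respectively, $t_i^\mu=o$ if and only if $\pi_{i,s}\ge c_s^o$). \textbf{Mechanisms.} A \emph{direct mechanism} $\psi$ maps every profile $P=(P_i)_{i\in I}$ of strict preferences to an augmented matching $\psi(P)$. It is \emph{individually rational} if $\psi_i(P)\,R_i\,\emptyset$ for all $P$ and $i$; \emph{strategy-proof}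 if $\psi_i(P)\,R_i\,\psi_i(P_i',P_{-i})$ for all $P$, $i$ and $P_i'$, where $\psi_i(P)$ is $i$'s school; and RO-verifiable (OR-verifiable) if $\psi(P)$ is so for every $P$. \textbf{SimRO and SimOR.} Given for each school a rule that chooses from each set of applicants the admitted students and their seat types, \emph{deferred acceptance} proceeds in rounds: each student not tentatively admitted applies to her most preferred acceptable school that has not rejected her, and each school applies its rule to a set of applicants, rejecting those not chosen; it stops when each student is tentatively admitted or has been rejected by all acceptable schools, and the rules' choices in the last round determine schools and seat types. There are two conventions: the set of applicants consists (a) of the new applicants and the students tentatively admitted by the school, or (b) of all students who have applied to the school so far. The theorem below holds under either convention. SimRO is deferred acceptance with the following rule for each $s$: for each type $m$ the highest-ranked applicants of type $m$ get reserved seats, up to $q_s^m$; then all remaining seats go, as open seats, to the highest-ranked remaining applicants. SimOR is deferred acceptance in which school $s$ chooses from an applicant set $A$ by running deferred acceptance between the students of $A$ and two subschools $s^o,s^r$ of $s$, where every student in $A$ ranks $s^o$ first and $s^r$ second; when a set $B$ applies to (or is held by) $s^o$ and a disjoint set $B'$ applies to (or is held by) $s^r$, for each $m$ the highest-ranked students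 of type $m$ in $B'$ get reserved seats, up to $q_s^m$, and all remaining seats of $s$ go, as open seats, to the highest-ranked students in $B$. \textbf{Theorem 2.} Fix either of the conventions (a), (b) for the deferred acceptance over schools in the definition of SimRO and SimOR. Let $\psi$ be an individually rational and strategy-proof direct mechanism. (1) If $\psi$ is RO-verifiable, then $\psi(P)=\mathrm{SimRO}(P)$ for every preference profile $P$. (2) If $\psi$ is OR-verifiable, then for every preference profile $P$, $\psi(P)$ and $\mathrm{SimOR}(P)$ induce the same standard matching, and the set of students who occupy reserved seats in $\psi(P)$ contains the set of students who occupy reserved seats in $\mathrm{SimOR}(P)$. -/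

import Mathlib

open scoped Classical in
/-- The fixed data of a school choice problem with reserve quotas: students `I`, schools `S`,
student types `M`. The priority order of school `s` is given by the scores at `s`: a larger score
means a higher priority, and distinct students have distinct scores. -/
structure Market (I S M : Type*) [Fintype I] [Fintype M] where
  /-- `q_s`, the number of seats at `s`. -/
  capacity : S → ℕ
  /-- `q_s^m`, the number of seats at `s` that are reserved for students of type `m`. -/
  reserve : S → M → ℕ
  /-- The type of each student. -/
  type : I → M
  /-- `π_{i,s}`, the priority score of student `i` at school `s`. -/
  score : I → S → ℕ
  score_injective : ∀ s, Function.Injective fun i => score i s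
  sum_reserve_lt : ∀ s, ∑ m, reserve s m < capacity s
  reserve_lt_card : ∀ s m, reserve s m < (Finset.univ.filter fun i => type i = m).card

/-- The two types of seats. -/
inductive SeatType
  | reservedSeat
  | openSeat

/-- A strict preference relation over the schools and the null school `none`;
`P.Prefers a b` means that `a` is strictly preferred to `b`. -/
structure Preference (S : Type*) where
  Prefers : Option S → Option S → Prop
  strictTotal : IsStrictTotalOrder (Option S) Prefers

/-- The weak preference `a R b`. -/
def Preference.WeaklyPrefers {S : Type*} (P : Preference S) (a b : Option S) : Prop :=
  P.Prefers a b ∨ a = b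

namespace Market

noncomputable section

open scoped Classical

variable {I S M : Type*} [Fintype I] [Fintype M]

/-! ### Augmented matchings -/

/-- An augmented matching: every student is either unmatched (`none`) or admitted to a seat of a
given type at a school. The seat type of an unmatched student is irrelevant and not recorded. -/
@[ext]
structure AugmentedMatching (E : Market I S M) where
  assign : I → Option (S × SeatType)
  card_le_capacity : ∀ s,
    (Finset.univ.filter fun i => ∃ t, assign i = some (s, t)).card ≤ E.capacity s
  card_le_reserve : ∀ s m,
    (Finset.univ.filter fun i =>
      E.type i = m ∧ assign i = some (s, SeatType.reservedSeat)).card ≤ E.reserve s m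

namespace AugmentedMatching

variable {E : Market I S M} (μ : E.AugmentedMatching)

/-- `μ(i)`: the school (or null school) of student `i`. As a function of `i` this is the standard
matching induced by `μ`. -/
def school (i : I) : Option S := (μ.assign i).map Prod.fst

/-- `μ(s)`: the students admitted to school `s`. -/
def admitted (s : S) : Finset I := Finset.univ.filter fun i => ∃ t, μ.assign i = some (s, t)

/-- `μ^o(s)`: the students who occupy open seats at `s`. -/
def openAt (s : S) : Finset I :=
  Finset.univ.filter fun i => μ.assign i = some (s, SeatType.openSeat)

/-- `μ^{rm}(s)`: the students of type `m` who occupy reserved seats at `s`. -/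
def reservedAt (s : S) (m : M) : Finset I :=
  Finset.univ.filter fun i => E.type i = m ∧ μ.assign i = some (s, SeatType.reservedSeat)

/-- The set of all students who occupy reserved seats (at any school). -/
def reservedStudents : Set I := {i | ∃ s, μ.assign i = some (s, SeatType.reservedSeat)}

/-- The cutoff `c^m_s` for the reserved seats of type `m` at school `s`. -/
def reservedCutoff (s : S) (m : M) : ℕ∞ :=
  if E.reserve s m = 0 then ⊤
  else if (μ.reservedAt s m).card = E.reserve s m then
    (μ.reservedAt s m).inf fun i => (E.score i s : ℕ∞)
  else 0

/-- The cutoff `c^o_s` for the open seats at school `s`. (A full school always has students in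
open seats, because its reserve quotas add up to less than its capacity.) -/
def openCutoff (s : S) : ℕ∞ :=
  if (μ.admitted s).card = E.capacity s then
    (μ.openAt s).inf fun i => (E.score i s : ℕ∞)
  else 0

/-- The set of schools affordable to student `i`. The cutoffs of the null school are zero, so it
is affordable to everyone. -/
def affordable (i : I) : Set (Option S) :=
  {x | ∀ s, x = some s →
    min (μ.reservedCutoff s (E.type i)) (μ.openCutoff s) ≤ (E.score i s : ℕ∞)}

/-- Every student is assigned to her most preferred affordable school,
`μ(i) = max (P_i, S_i^μ)`. -/
def BestAffordable (P : I → Preference S) : Prop :=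
  ∀ i, μ.school i ∈ μ.affordable i ∧
    ∀ x ∈ μ.affordable i, (P i).WeaklyPrefers (μ.school i) x

/-- RO-verifiability of an augmented matching: students get their best affordable schools, and an
admitted student has a reserved seat if her score reaches the cutoff for the reserved seats of her
type, and an open seat otherwise. -/
def ROVerifiable (P : I → Preference S) : Prop :=
  μ.BestAffordable P ∧
    ∀ i s t, μ.assign i = some (s, t) →
      t = if μ.reservedCutoff s (E.type i) ≤ (E.score i s : ℕ∞)
        then SeatType.reservedSeat else SeatType.openSeat

/-- OR-verifiability of an augmented matching: students get their best affordable schools, and an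
admitted student has an open seat if her score reaches the cutoff for open seats, and a reserved
seat otherwise. -/
def ORVerifiable (P : I → Preference S) : Prop :=
  μ.BestAffordable P ∧
    ∀ i s t, μ.assign i = some (s, t) →
      t = if μ.openCutoff s ≤ (E.score i s : ℕ∞)
        then SeatType.openSeat else SeatType.reservedSeat

/-- No student is assigned to an unacceptable school. -/
def IndividuallyRational (P : I → Preference S) : Prop :=
  ∀ i, (P i).WeaklyPrefers (μ.school i) none

end AugmentedMatching

/-! ### Direct mechanisms -/

/-- A direct mechanism finds an augmented matching for every profile of strict preferences. -/
abbrev DirectMechanism (E : Market I S M) := (I → Preference S) → E.AugmentedMatching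

namespace DirectMechanism

variable {E : Market I S M} (ψ : E.DirectMechanism)

def IndividuallyRational : Prop := ∀ P, (ψ P).IndividuallyRational P

/-- No student can gain by misreporting her preferences. -/
def StrategyProof : Prop :=
  ∀ (P : I → Preference S) (i : I) (P' : Preference S),
    (P i).WeaklyPrefers ((ψ P).school i) ((ψ (Function.update P i P')).school i)

def ROVerifiable : Prop := ∀ P, (ψ P).ROVerifiable P

def ORVerifiable : Prop := ∀ P, (ψ P).ORVerifiable P

end DirectMechanism

/-! ### Augmented choice rules and deferred acceptance -/

/-- An augmented choice rule of school `s`: from every set `A` of applicants it admits some, and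
gives each of them a seat of some type, subject to the capacity and the reserve quotas of `s`.
`seat A i = none` means that `i` is not chosen from `A`. -/
structure ChoiceRule (E : Market I S M) (s : S) where
  seat : Finset I → I → Option SeatType
  seat_eq_none : ∀ A i, i ∉ A → seat A i = none
  card_le_capacity : ∀ A, (Finset.univ.filter fun i => seat A i ≠ none).card ≤ E.capacity s
  card_le_reserve : ∀ A m,
    (Finset.univ.filter fun i =>
      E.type i = m ∧ seat A i = some SeatType.reservedSeat).card ≤ E.reserve s m

/-- If `(i, s) ∈ X` means that `s` has rejected `i`, then `IsTarget P X i s` says that `s` is the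
best school for `i` among the acceptable schools that have not rejected her. -/
def IsTarget (P : I → Preference S) (X : Finset (I × S)) (i : I) (s : S) : Prop :=
  (P i).Prefers (some s) none ∧ (i, s) ∉ X ∧
    ∀ s', (i, s') ∉ X → (P i).WeaklyPrefers (some s) (some s')

/-- The school to which `i` applies, or which holds her tentatively, given the rejections `X`;
it is `none` if all acceptable schools have rejected her. -/
def target (P : I → Preference S) (X : Finset (I × S)) (i : I) : Option S :=
  if h : ∃ s, IsTarget P X i s then some h.choose else none

theorem target_eq_some_iff {I S : Type*} (P : I → Preference S) (X : Finset (I × S)) (i : I) (s : S) :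
    target P X i = some s ↔ IsTarget P X i s := by
  have := (P i).strictTotal
  have huniq : ∀ a b, IsTarget P X i a → IsTarget P X i b → a = b := by
    intro a b ha hb
    rcases ha.2.2 b hb.2.1 with h1 | h1
    · rcases hb.2.2 a ha.2.1 with h2 | h2
      · exact absurd (_root_.trans h1 h2) (irrefl _)
      · exact (Option.some.inj h2).symm
    · exact Option.some.inj h1
  unfold target
  split_ifs with h
  · constructor
    · intro hs
      rw [← Option.some.inj hs]
      exact h.choose_spec
    · intro hs
      rw [huniq _ _ h.choose_spec hs]
  · simp only [false_iff]
    exact fun hs => h ⟨s, hs⟩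

/-- Two ways to run deferred acceptance: in each round a school applies its choice rule either
to its new applicants together with the students it has tentatively admitted, or to all students
who have applied to it so far (cumulative offers). For substitutable and `q`-acceptant choice
rules both lead to the same school for every student, but the seat types may differ. -/
inductive OfferConvention
  | tentative
  | cumulative

/-- The set of students to which `s` applies its choice rule in a round of deferred acceptance,
given the rejections `X`. Under the first convention these are the new applicants and the
tentatively admitted students; under the second, also all students whom `s` has rejected. -/
def applicants (v : OfferConvention) (P : I → Preference S) (X : Finset (I × S)) (s : S) :
    Finset I :=
  match v with
  | .tentative => Finset.univ.filter fun i => target P X i = some s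
  | .cumulative => Finset.univ.filter fun i => target P X i = some s ∨ (i, s) ∈ X

/-- One round of deferred acceptance: every school adds the applicants that its choice rule does
not admit to the rejections. -/
def daStep [Fintype S] (v : OfferConvention) (E : Market I S M) (C : ∀ s, E.ChoiceRule s)
    (P : I → Preference S) (X : Finset (I × S)) : Finset (I × S) :=
  X ∪ Finset.univ.filter fun p =>
    p.1 ∈ applicants v P X p.2 ∧ (C p.2).seat (applicants v P X p.2) p.1 = none

/-- Given the rejections `X` before a round, this round is the last one: after it, every student is
still held by the school to which she has applied, or has been rejected by all acceptable
schools. -/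
def IsLastRound [Fintype S] (v : OfferConvention) (E : Market I S M) (C : ∀ s, E.ChoiceRule s)
    (P : I → Preference S) (X : Finset (I × S)) : Prop :=
  ∀ i, target P (daStep v E C P X) i = target P X i ∨ target P (daStep v E C P X) i = none

/-- The rejections made before the last round of deferred acceptance. Every round before the last
one makes a new rejection, so the last round is reached within `|I × S|` iterations. -/
def daRejections [Fintype S] (v : OfferConvention) (E : Market I S M) (C : ∀ s, E.ChoiceRule s)
    (P : I → Preference S) : Finset (I × S) :=
  (fun X => if IsLastRound v E C P X then X else daStep v E C P X)^[Fintype.card (I × S)] ∅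

/-- The deferred acceptance mechanism with choice rules `C`: the schools' choices in the last round
determine the schools and the seat types of all students. -/
def deferredAcceptance [Fintype S] (v : OfferConvention) (E : Market I S M)
    (C : ∀ s, E.ChoiceRule s) : E.DirectMechanism :=
  fun P =>
  { assign := fun i =>
      (target P (daRejections v E C P) i).bind fun s =>
        ((C s).seat (applicants v P (daRejections v E C P) s) i).map fun t => (s, t)
    card_le_capacity := by
      intro s
      refine le_trans (Finset.card_le_card ?_)
        ((C s).card_le_capacity (applicants v P (daRejections v E C P) s))
      intro i hi
      simp only [Finset.mem_filter, Finset.mem_univ, true_and, Option.bind_eq_some_iff,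
        Option.map_eq_some_iff, Prod.mk.injEq] at hi ⊢
      obtain ⟨t, s', -, t', ht', rfl, rfl⟩ := hi
      simp [ht']
    card_le_reserve := by
      intro s m
      refine le_trans (Finset.card_le_card ?_)
        ((C s).card_le_reserve (applicants v P (daRejections v E C P) s) m)
      intro i hi
      simp only [Finset.mem_filter, Finset.mem_univ, true_and, Option.bind_eq_some_iff,
        Option.map_eq_some_iff, Prod.mk.injEq] at hi ⊢
      obtain ⟨hm, s', -, t', ht', rfl, rfl⟩ := hi
      exact ⟨hm, ht'⟩ }

/-! ### The choice rules SimRO and SimOR -/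

/-- The `k` students in `A` with the highest priority at `s` (all of `A` if `|A| ≤ k`). -/
def top (E : Market I S M) (s : S) (k : ℕ) (A : Finset I) : Finset I :=
  A.filter fun i => (A.filter fun j => E.score i s < E.score j s).card < k

/-- For each type `m`, the highest-ranked students of type `m` in `A`, up to the reserve quota. -/
def reservedPick (E : Market I S M) (s : S) (A : Finset I) : Finset I :=
  Finset.univ.biUnion fun m => E.top s (E.reserve s m) (A.filter fun i => E.type i = m)

/-- If reserved seats go to the students in `R`, all remaining seats go to the highest-ranked
students in `A`. -/
def openPick (E : Market I S M) (s : S) (R A : Finset I) : Finset I :=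
  E.top s (E.capacity s - R.card) A

/-- The seat assignment in which the students in `R` have reserved seats, and the (other)
students in `O` have open seats. -/
def seating (R O : Finset I) (i : I) : Option SeatType :=
  if i ∈ R then some SeatType.reservedSeat
  else if i ∈ O then some SeatType.openSeat
  else none

theorem card_top_le (E : Market I S M) (s : S) (k : ℕ) (A : Finset I) :
    (E.top s k A).card ≤ k := by
  have hinj : Set.InjOn (fun i => (A.filter fun j => E.score i s < E.score j s).card)
      (E.top s k A : Set I) := by
    have key : ∀ i j, j ∈ A → E.score i s < E.score j s →
        (A.filter fun l => E.score j s < E.score l s).card <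
          (A.filter fun l => E.score i s < E.score l s).card := by
      intro i j hj hij
      apply Finset.card_lt_card
      rw [Finset.ssubset_iff_of_subset]
      · exact ⟨j, by simp [hj, hij], by simp⟩
      · intro l hl
        simp only [Finset.mem_filter] at hl ⊢
        exact ⟨hl.1, hij.trans hl.2⟩
    intro i hi j hj hij
    simp only [top, Finset.coe_filter, Set.mem_ofPred_eq] at hi hj
    rcases lt_trichotomy (E.score i s) (E.score j s) with h | h | h
    · exact absurd hij (key i j hj.1 h).ne'
    · exact E.score_injective s h
    · exact absurd hij (key j i hi.1 h).ne
  have hmaps : Set.MapsTo (fun i => (A.filter fun j => E.score i s < E.score j s).card)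
      (E.top s k A : Set I) (Finset.range k : Set ℕ) := by
    intro i hi
    simp only [top, Finset.coe_filter, Set.mem_ofPred_eq] at hi
    simpa using hi.2
  simpa using Finset.card_le_card_of_injOn _ hmaps hinj

theorem card_reservedPick_le (E : Market I S M) (s : S) (A : Finset I) :
    (E.reservedPick s A).card ≤ E.capacity s :=
  (Finset.card_biUnion_le.trans (Finset.sum_le_sum fun _ _ => E.card_top_le s _ _)).trans
    (E.sum_reserve_lt s).le

theorem card_seating_le (E : Market I S M) (s : S) (A A' : Finset I) :
    (Finset.univ.filter fun i =>
      seating (E.reservedPick s A') (E.openPick s (E.reservedPick s A') A) i ≠ none).card ≤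
        E.capacity s := by
  refine (Finset.card_le_card (t := E.reservedPick s A' ∪
    E.openPick s (E.reservedPick s A') A) ?_).trans ((Finset.card_union_le _ _).trans ?_)
  · intro i hi
    rw [Finset.mem_filter] at hi
    by_contra h
    rw [Finset.mem_union, not_or] at h
    exact hi.2 (by rw [seating, if_neg h.1, if_neg h.2])
  · have h1 := E.card_reservedPick_le s A'
    have h2 := E.card_top_le s (E.capacity s - (E.reservedPick s A').card) A
    unfold openPick
    omega

theorem card_seating_reserved_le (E : Market I S M) (s : S) (A' O : Finset I) (m : M) :
    (Finset.univ.filter fun i => E.type i = m ∧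
      seating (E.reservedPick s A') O i = some SeatType.reservedSeat).card ≤ E.reserve s m := by
  refine (Finset.card_le_card ?_).trans
    (E.card_top_le s (E.reserve s m) (A'.filter fun i => E.type i = m))
  intro i hi
  rw [Finset.mem_filter] at hi
  obtain ⟨-, hm, hi⟩ := hi
  have hR : i ∈ E.reservedPick s A' := by
    by_contra h
    rw [seating, if_neg h] at hi
    split_ifs at hi
    simp at hi
  simp only [reservedPick, Finset.mem_biUnion, Finset.mem_univ, true_and] at hR
  obtain ⟨m', hm'⟩ := hR
  have : E.type i = m' := by
    simp only [top, Finset.mem_filter] at hm'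
    exact hm'.1.2
  rwa [← hm, this]

theorem seating_eq_none (E : Market I S M) (s : S) (A A' R : Finset I) (i : I)
    (hA : i ∉ A) (hA' : i ∉ A') :
    seating (E.reservedPick s A') (E.openPick s R A) i = none := by
  have h1 : i ∉ E.reservedPick s A' := by simp [reservedPick, top, hA']
  have h2 : i ∉ E.openPick s R A := by simp [openPick, top, hA]
  simp [seating, h1, h2]

/-- The choice rule SimRO: first, for each type, the highest-ranked applicants of that type get
reserved seats up to the reserve quota; then all remaining seats go, as open seats, to the
highest-ranked remaining applicants. -/
def simROChoice (E : Market I S M) (s : S) : E.ChoiceRule s where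
  seat A :=
    seating (E.reservedPick s A) (E.openPick s (E.reservedPick s A) (A \ E.reservedPick s A))
  seat_eq_none A i hi := E.seating_eq_none s _ _ _ i (by simp [hi]) hi
  card_le_capacity A := E.card_seating_le s _ _
  card_le_reserve A m := E.card_seating_reserved_le s _ _ m

/-- Applicants to the open subschool `s^o`: the students in `A` not yet rejected by it. (`X` is the
set of rejections by the two subschools; all students prefer `s^o` to `s^r`.) -/
def openApplicants (A : Finset I) (X : Finset (I × SeatType)) : Finset I :=
  A.filter fun i => (i, SeatType.openSeat) ∉ X

/-- Applicants to the reserved subschool `s^r`: the students in `A` who have been rejected by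
`s^o` and not by `s^r`. -/
def reservedApplicants (A : Finset I) (X : Finset (I × SeatType)) : Finset I :=
  A.filter fun i => (i, SeatType.openSeat) ∈ X ∧ (i, SeatType.reservedSeat) ∉ X

/-- The choice rule SimFlex for a set `A` of applicants to `s^o` and a disjoint set `A'` of
applicants to `s^r`: reserved seats go to the highest-ranked students of each type in `A'` up to
the reserve quotas, and all remaining seats go, as open seats, to the highest-ranked students
in `A`. -/
def simFlex (E : Market I S M) (s : S) (A A' : Finset I) : I → Option SeatType :=
  seating (E.reservedPick s A') (E.openPick s (E.reservedPick s A') A)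

/-- One round of the deferred acceptance procedure in the artificial economy of the two subschools
of `s` and the students in `A`, where `s` chooses by SimFlex. -/
def simORStep (E : Market I S M) (s : S) (A : Finset I) (X : Finset (I × SeatType)) :
    Finset (I × SeatType) :=
  X ∪
    (((openApplicants A X).filter fun i =>
      E.simFlex s (openApplicants A X) (reservedApplicants A X) i = none).image
        fun i => (i, SeatType.openSeat)) ∪
    (((reservedApplicants A X).filter fun i =>
      E.simFlex s (openApplicants A X) (reservedApplicants A X) i = none).image
        fun i => (i, SeatType.reservedSeat))

/-- All rejections in that procedure. Every round but the last makes a new rejection, so `2 |I|`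
rounds suffice; further rounds change nothing. -/
def simORRejections (E : Market I S M) (s : S) (A : Finset I) : Finset (I × SeatType) :=
  (E.simORStep s A)^[2 * Fintype.card I] ∅

/-- The choice rule SimOR: the result of deferred acceptance in the artificial economy that
consists of school `s` and the applicants in `A`, who all prefer `s^o` to `s^r`, where `s` chooses
by SimFlex. -/
def simORChoice (E : Market I S M) (s : S) : E.ChoiceRule s where
  seat A := E.simFlex s (openApplicants A (E.simORRejections s A))
    (reservedApplicants A (E.simORRejections s A))
  seat_eq_none A i hi := E.seating_eq_none s _ _ _ i
    (by simp [openApplicants, hi]) (by simp [reservedApplicants, hi])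
  card_le_capacity A := E.card_seating_le s _ _
  card_le_reserve A m := E.card_seating_reserved_le s _ _ m

/-- The mechanism SimRO: deferred acceptance in which every school uses the choice rule SimRO. -/
def simRO [Fintype S] (v : OfferConvention) (E : Market I S M) : E.DirectMechanism :=
  deferredAcceptance v E E.simROChoice

/-- The mechanism SimOR: deferred acceptance in which every school uses the choice rule SimOR. -/
def simOR [Fintype S] (v : OfferConvention) (E : Market I S M) : E.DirectMechanism :=
  deferredAcceptance v E E.simORChoice

end

end Market

/-!
In a verifiable matching `μ` nobody can afford a school that she envies. The choice rules fit to
this notion of affordability in the sense of `Market.Respects`: from any set of applicants who are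
admitted to `s` under `μ` or cannot afford `s` under `μ`, the school `s` keeps those whom it has
under `μ`. For SimRO this is a count by types
(`respects_simROChoice`); for SimOR it is an invariant of the deferred acceptance between the two
subschools (`rejectionsRespect_simORStep`), which moreover shows that SimOR never denies an open
seat to a student who has one under `μ`.

Hence deferred acceptance never rejects a student from a school she can afford under `μ`, and its
outcome `δ` is at least as good as `μ` for everyone. To see that a strategy-proof mechanism `ψ`
cannot fall short of `δ`, let the students outside a set `T` truncate their preferences at their
outcomes under `δ` (`school_truncatedProfile`). The domination by `δ` persists at these profiles.
By induction on `T`, strategy-proofness gives the students in `T` no less than `δ`. The others get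
their school under `δ` or nothing; if somebody got nothing, then her school under `δ` would have a
free seat and so be affordable to her. With `T` the set of all students, `ψ` has the schools of
`δ`. The stability of `δ` itself is never needed.

It remains to compare seat types. The cutoffs determine the reserved seats of an RO-verifiable
matching from its schools, and in the case of SimOR the invariant above gives the inclusion.
-/

/-! ### Truncated preferences -/

namespace Preference

variable {S : Type*} (P : Preference S) {a b c : Option S}

theorem not_prefers_self : ¬ P.Prefers a a :=
  have := P.strictTotal
  irrefl a

variable {P}

theorem Prefers.trans (hab : P.Prefers a b) (hbc : P.Prefers b c) : P.Prefers a c :=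
  have := P.strictTotal
  _root_.trans hab hbc

theorem WeaklyPrefers.trans_prefers (hab : P.WeaklyPrefers a b) (hbc : P.Prefers b c) :
    P.Prefers a c := by
  rcases hab with hab | rfl
  exacts [hab.trans hbc, hbc]

theorem WeaklyPrefers.not_prefers (hab : P.WeaklyPrefers a b) : ¬ P.Prefers b a :=
  fun h => P.not_prefers_self (hab.trans_prefers h)

theorem prefers_of_not_weaklyPrefers (h : ¬ P.WeaklyPrefers a b) : P.Prefers b a := by
  have := P.strictTotal
  rw [WeaklyPrefers, not_or] at h
  rcases trichotomous_of P.Prefers a b with h' | h' | h'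
  exacts [absurd h' h.1, absurd h' h.2, h']

theorem weaklyPrefers_of_not_prefers (h : ¬ P.Prefers a b) : P.WeaklyPrefers b a :=
  not_not.1 fun h' => h (prefers_of_not_weaklyPrefers h')

variable (P) in
/-- The preference `P` truncated at `x`: everything that is at least as good as `x` stays on top
in its old order, the null school (if it is not among these) comes next, and then follows the
rest in its old order. So if `x` is not worse than the null school, the schools below `x` become
unacceptable, and nothing else changes. -/
def truncate (x : Option S) : Preference S where
  Prefers a b := (P.WeaklyPrefers a x ∧ P.Prefers a b) ∨
    (¬ P.WeaklyPrefers a x ∧ ¬ P.WeaklyPrefers b x ∧ b ≠ none ∧ (a = none ∨ P.Prefers a b))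
  strictTotal :=
    { trichotomous := by
        intro a b hab hba
        have := P.strictTotal
        by_contra hne
        have key : ∀ c d, P.WeaklyPrefers c x → ¬ P.WeaklyPrefers d x → P.Prefers c d :=
          fun c d hc hd => hc.trans_prefers (prefers_of_not_weaklyPrefers hd)
        have h1 := key a b
        have h2 := key b a
        have h3 : ¬ P.Prefers a b → P.Prefers b a := fun h =>
          (weaklyPrefers_of_not_prefers h).resolve_right (Ne.symm hne)
        by_cases ha : a = none <;> by_cases hb : b = none
        · exact hne (ha.trans hb.symm)
        all_goals tauto
      irrefl := by
        rintro a (⟨-, h⟩ | ⟨-, -, h, h' | h'⟩)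
        exacts [P.not_prefers_self h, h h', P.not_prefers_self h']
      trans := by
        rintro a b c (⟨ha, hab⟩ | ⟨ha, hb, hb', hab⟩) (⟨hb2, hbc⟩ | ⟨hb2, hc, hc', hbc⟩)
        · exact .inl ⟨ha, hab.trans hbc⟩
        · exact .inl ⟨ha, ha.trans_prefers (prefers_of_not_weaklyPrefers hc)⟩
        · exact absurd hb2 hb
        · refine .inr ⟨ha, hc, hc', hab.imp_right fun h => h.trans (hbc.resolve_left hb')⟩ }

theorem Prefers.truncate {x : Option S} (hab : P.Prefers a b) (ha : P.WeaklyPrefers a x) :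
    (P.truncate x).Prefers a b :=
  .inl ⟨ha, hab⟩

theorem weaklyPrefers_of_truncate {x : Option S} (ha : (P.truncate x).WeaklyPrefers a none)
    (hne : a ≠ none) : P.WeaklyPrefers a x := by
  rcases ha with (⟨ha, -⟩ | ⟨-, -, h, -⟩) | ha
  exacts [ha, absurd rfl h, absurd ha hne]

end Preference

namespace Market

open scoped Classical

/-! ### Iterating an inflationary map on finite sets -/

/-- An inflationary map on the subsets of `α`, iterated from the empty set, becomes stationary
within `|α|` rounds, because every round before that adds an element. -/
theorem iterate_card_fixed {α : Type*} [Fintype α] (f : Finset α → Finset α)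
    (hf : ∀ X, X ⊆ f X) :
    f (f^[Fintype.card α] ∅) = f^[Fintype.card α] ∅ := by
  have key : ∀ k, f (f^[k] ∅) = f^[k] ∅ ∨ k < (f^[k + 1] ∅).card := by
    intro k
    induction k with
    | zero =>
      refine or_iff_not_imp_left.2 fun h => ?_
      exact Nat.zero_lt_of_lt (Finset.card_lt_card ((hf ∅).ssubset_of_ne (Ne.symm h)))
    | succ k ih =>
      refine or_iff_not_imp_left.2 fun h => ?_
      have h' : ¬ f (f^[k] ∅) = f^[k] ∅ := by
        intro hk
        apply h
        rw [Function.iterate_succ_apply', hk, hk]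
      have h2 := Finset.card_lt_card ((hf (f^[k + 1] ∅)).ssubset_of_ne (Ne.symm h))
      rw [← Function.iterate_succ_apply' f] at h2
      exact lt_of_le_of_lt (ih.resolve_left h') h2
  refine (key _).resolve_right ?_
  exact not_lt.2 (Finset.card_le_univ _)

theorem subset_iterate {α : Type*} {f : Finset α → Finset α} (hf : ∀ X, X ⊆ f X) {m n : ℕ}
    (hmn : m ≤ n) : f^[m] ∅ ⊆ f^[n] ∅ :=
  Function.monotone_iterate_of_id_le hf hmn ∅

/-! ### Rejections in deferred acceptance -/

variable {I S M : Type*}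

variable {P : I → Preference S}

theorem mem_of_target_eq_none [Finite S] {X : Finset (I × S)} {i : I} {s : S}
    (h : target P X i = none) (hs : (P i).Prefers (some s) none) : (i, s) ∈ X := by
  by_contra hX
  have := (P i).strictTotal
  -- A best school for `i` among those that have not rejected her would be her target.
  obtain ⟨b, hb, hmax⟩ := (Finite.wellFounded_of_trans_of_irrefl (P i).Prefers).has_min
    {x | ∃ s', x = some s' ∧ (i, s') ∉ X} ⟨some s, s, rfl, hX⟩
  obtain ⟨b, rfl, hbX⟩ := hb
  have hw : ∀ s', (i, s') ∉ X → (P i).WeaklyPrefers (some b) (some s') := fun s' hs' =>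
    Preference.weaklyPrefers_of_not_prefers (hmax _ ⟨s', rfl, hs'⟩)
  have ht := (target_eq_some_iff P X i b).2 ⟨(hw s hX).trans_prefers hs, hbX, hw⟩
  rw [h] at ht
  cases ht

variable [Fintype I] {v : OfferConvention}

theorem mem_applicants_of_target {X : Finset (I × S)} {i : I} {s : S}
    (h : target P X i = some s) : i ∈ applicants v P X s := by
  cases v <;> simp [applicants, h]

theorem target_or_mem_of_mem_applicants {X : Finset (I × S)} {i : I} {s : S}
    (h : i ∈ applicants v P X s) : target P X i = some s ∨ (i, s) ∈ X := by
  cases v <;> simp [applicants] at h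
  exacts [.inl h, h]

variable [Fintype M] {E : Market I S M}

theorem AugmentedMatching.some_mem_affordable_of_card_lt {μ : E.AugmentedMatching} {s : S}
    (h : (μ.admitted s).card < E.capacity s) (i : I) : some s ∈ μ.affordable i := by
  rintro _ ⟨⟩
  simp [AugmentedMatching.openCutoff, h.ne]

theorem AugmentedMatching.mem_admitted {μ : E.AugmentedMatching} {s : S} {i : I} :
    i ∈ μ.admitted s ↔ μ.school i = some s := by
  simp only [admitted, school, Finset.mem_filter, Finset.mem_univ, true_and,
    Option.map_eq_some_iff, Prod.exists]
  constructor
  · rintro ⟨t, h⟩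
    exact ⟨_, _, h, rfl⟩
  · rintro ⟨_, t, h, rfl⟩
    exact ⟨t, h⟩

variable [Fintype S] {C : ∀ s, E.ChoiceRule s}

theorem subset_daStep (X : Finset (I × S)) : X ⊆ daStep v E C P X :=
  Finset.subset_union_left

theorem mem_daStep {X : Finset (I × S)} {i : I} {s : S} :
    (i, s) ∈ daStep v E C P X ↔ (i, s) ∈ X ∨
      i ∈ applicants v P X s ∧ (C s).seat (applicants v P X s) i = none := by
  simp [daStep]

/-- A round of deferred acceptance, which changes nothing once the last round is reached. -/
noncomputable def daRound (v : OfferConvention) (E : Market I S M) (C : ∀ s, E.ChoiceRule s)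
    (P : I → Preference S) (X : Finset (I × S)) : Finset (I × S) :=
  if IsLastRound v E C P X then X else daStep v E C P X

theorem subset_daRound (X : Finset (I × S)) : X ⊆ daRound v E C P X := by
  unfold daRound
  split_ifs
  exacts [subset_rfl, subset_daStep X]

theorem daRejections_eq_iterate :
    daRejections v E C P = (daRound v E C P)^[Fintype.card (I × S)] ∅ :=
  rfl

/-- The number of rounds that `daRejections` allows is enough to reach the last round. -/
theorem isLastRound_daRejections : IsLastRound v E C P (daRejections v E C P) := by
  have h := iterate_card_fixed (daRound v E C P) subset_daRound
  rw [← daRejections_eq_iterate] at h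
  by_contra hl
  rw [daRound, if_neg hl] at h
  exact hl fun i => .inl (by rw [h])

theorem deferredAcceptance_school_eq_some_iff {i : I} {s : S} :
    (deferredAcceptance v E C P).school i = some s ↔
      target P (daRejections v E C P) i = some s ∧
        (C s).seat (applicants v P (daRejections v E C P) s) i ≠ none := by
  simp only [AugmentedMatching.school, deferredAcceptance, Option.map_eq_some_iff,
    Option.bind_eq_some_iff, Option.ne_none_iff_exists']
  constructor
  · rintro ⟨_, ⟨s', hs', t, ht, rfl⟩, rfl⟩
    exact ⟨hs', t, ht⟩
  · rintro ⟨hs, t, ht⟩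
    exact ⟨_, ⟨s, hs, t, ht, rfl⟩, rfl⟩

/-- At the end of deferred acceptance, a student has been rejected by all schools that she prefers
to her outcome and finds acceptable. -/
theorem mem_daStep_of_prefers {i : I} {s : S}
    (hs : (P i).Prefers (some s) ((deferredAcceptance v E C P).school i))
    (hacc : (P i).Prefers (some s) none) :
    (i, s) ∈ daStep v E C P (daRejections v E C P) := by
  cases htar : target P (daRejections v E C P) i with
  | none => exact subset_daStep _ (mem_of_target_eq_none htar hacc)
  | some b =>
    by_cases hseat : (C b).seat (applicants v P (daRejections v E C P) b) i = none
    · have hb : (i, b) ∈ daStep v E C P (daRejections v E C P) :=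
        mem_daStep.2 (.inr ⟨mem_applicants_of_target htar, hseat⟩)
      have hne : target P (daStep v E C P (daRejections v E C P)) i ≠ some b := fun h =>
        ((target_eq_some_iff _ _ _ _).1 h).2.1 hb
      refine mem_of_target_eq_none
        ((isLastRound_daRejections i).resolve_left ?_) hacc
      rwa [htar]
    · rw [deferredAcceptance_school_eq_some_iff.2 ⟨htar, hseat⟩] at hs
      refine subset_daStep _ (not_not.1 fun hX => ?_)
      exact (((target_eq_some_iff _ _ _ _).1 htar).2.2 s hX).not_prefers hs

theorem deferredAcceptance_school_prefers_none {i : I} {s : S}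
    (h : (deferredAcceptance v E C P).school i = some s) : (P i).Prefers (some s) none :=
  ((target_eq_some_iff _ _ _ _).1 (deferredAcceptance_school_eq_some_iff.1 h).1).1

/-- A school to which a student applies at some time is at least as good as her outcome. -/
theorem weaklyPrefers_of_target {X : Finset (I × S)} (hX : X ⊆ daRejections v E C P) {i : I}
    {s : S} (h : target P X i = some s) :
    (P i).WeaklyPrefers (some s) ((deferredAcceptance v E C P).school i) := by
  obtain ⟨hacc, -, hbest⟩ := (target_eq_some_iff _ _ _ _).1 h
  cases hda : (deferredAcceptance v E C P).school i with
  | none => exact .inl hacc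
  | some b =>
    have := ((target_eq_some_iff _ _ _ _).1 (deferredAcceptance_school_eq_some_iff.1 hda).1).2.1
    exact hbest b fun hb => this (hX hb)

/-! ### Comparison with strategy-proof mechanisms -/

/-- The choice rules `C` respect the matching `μ` if no school rejects a student whom it has under
`μ`, as long as all other applicants are students who cannot afford it under `μ`. -/
def Respects (C : ∀ s, E.ChoiceRule s) (μ : E.AugmentedMatching) : Prop :=
  ∀ (s : S) (A : Finset I), (∀ j ∈ A, μ.school j = some s ∨ some s ∉ μ.affordable j) →
    ∀ i ∈ A, μ.school i = some s → (C s).seat A i ≠ none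

section Rejections

variable {μ : E.AugmentedMatching} (haff : ∀ i, μ.school i ∈ μ.affordable i)
  (hC : Respects C μ)
  (henvy : ∀ i s, (P i).Prefers (some s) (μ.school i) →
    (P i).WeaklyPrefers (some s) ((deferredAcceptance v E C P).school i) →
    some s ∉ μ.affordable i)

include haff henvy

theorem applicants_school_or_not_affordable {X : Finset (I × S)}
    (hX : X ⊆ daRejections v E C P)
    (hrej : ∀ i s, (i, s) ∈ X → some s ∉ μ.affordable i) {s : S} {j : I}
    (hj : j ∈ applicants v P X s) : μ.school j = some s ∨ some s ∉ μ.affordable j := by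
  rcases target_or_mem_of_mem_applicants hj with ht | hj
  · refine or_iff_not_imp_left.2 fun hne => ?_
    obtain ⟨hacc, -, hbest⟩ := (target_eq_some_iff _ _ _ _).1 ht
    have hw : (P j).WeaklyPrefers (some s) (μ.school j) := by
      cases hsch : μ.school j with
      | none => exact .inl hacc
      | some b => exact hbest b fun hb => hrej j b hb (hsch ▸ haff j)
    exact henvy j s (hw.resolve_right (Ne.symm hne)) (weaklyPrefers_of_target hX ht)
  · exact .inr (hrej j s hj)

include hC

theorem not_affordable_of_mem_daStep {X : Finset (I × S)} (hX : X ⊆ daRejections v E C P)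
    (hrej : ∀ i s, (i, s) ∈ X → some s ∉ μ.affordable i) {i : I} {s : S}
    (h : (i, s) ∈ daStep v E C P X) : some s ∉ μ.affordable i := by
  have hA := fun j => applicants_school_or_not_affordable haff henvy hX hrej (s := s) (j := j)
  rcases mem_daStep.1 h with h | ⟨hi, hseat⟩
  · exact hrej i s h
  · exact (hA i hi).resolve_left fun hs => hC s _ hA i hi hs hseat

/-- If `μ` gives every student an affordable school and nobody can afford a school that she
envies, then deferred acceptance never rejects a student from a school she can afford under `μ`. -/
theorem not_affordable_of_mem_daRejections {i : I} {s : S} (h : (i, s) ∈ daRejections v E C P) :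
    some s ∉ μ.affordable i := by
  have key : ∀ n ≤ Fintype.card (I × S), ∀ i s, (i, s) ∈ (daRound v E C P)^[n] ∅ →
      some s ∉ μ.affordable i := by
    intro n
    induction n with
    | zero => simp
    | succ n ih =>
      intro hn i s his
      rw [Function.iterate_succ_apply'] at his
      have ih := ih (by omega)
      by_cases hl : IsLastRound v E C P ((daRound v E C P)^[n] ∅)
      · exact ih i s (by simpa only [daRound, if_pos hl] using his)
      · refine not_affordable_of_mem_daStep haff hC henvy
          (subset_iterate subset_daRound (by omega)) ih (i := i) (s := s) ?_
        simpa only [daRound, if_neg hl] using his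
  exact key _ le_rfl i s h

end Rejections

/-- Students in `T` report their preferences, and all others truncate them at their outcomes of
deferred acceptance. -/
noncomputable def truncatedProfile (μ : E.AugmentedMatching) (P : I → Preference S)
    (T : Finset I) (i : I) : Preference S :=
  if i ∈ T then P i else (P i).truncate (μ.school i)

/-- A strategy-proof mechanism whose outcomes are respected by the choice rules yields the
deferred acceptance outcome at each profile, where the students outside `T` have truncated their
preferences at that outcome. -/
theorem school_truncatedProfile {ψ : E.DirectMechanism} (hIR : ψ.IndividuallyRational)
    (hSP : ψ.StrategyProof) (hbest : ∀ P, (ψ P).BestAffordable P)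
    (hC : ∀ P, Respects C (ψ P)) (P : I → Preference S) (T : Finset I) :
    ∀ i, (ψ (truncatedProfile (deferredAcceptance v E C P) P T)).school i =
      (deferredAcceptance v E C P).school i := by
  induction T using Finset.strongInduction with
  | H T ih =>
  set δ := deferredAcceptance v E C P with hδ
  set Q := truncatedProfile δ P T with hQ
  set μ := ψ Q with hμ
  have hQP : ∀ i a b, (P i).Prefers a b → (P i).WeaklyPrefers a (δ.school i) →
      (Q i).Prefers a b := by
    intro i a b hab ha
    simp only [hQ, truncatedProfile]
    split_ifs
    exacts [hab, hab.truncate ha]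
  have henvy : ∀ i s, (P i).Prefers (some s) (μ.school i) →
      (P i).WeaklyPrefers (some s) (δ.school i) → some s ∉ μ.affordable i :=
    fun i s h1 h2 h3 => ((hbest Q i).2 _ h3).not_prefers (hQP i _ _ h1 h2)
  have haff := fun i => (hbest Q i).1
  -- Deferred acceptance is at least as good as `μ` for every student.
  have hdom : ∀ i, ¬ (P i).Prefers (μ.school i) (δ.school i) := by
    intro i hi
    have hδnone : (P i).WeaklyPrefers (δ.school i) none := by
      cases h : δ.school i with
      | none => exact .inr rfl
      | some b => exact .inl (deferredAcceptance_school_prefers_none h)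
    have hacc : (P i).Prefers (μ.school i) none := by
      rcases hδnone with h | h
      exacts [hi.trans h, h ▸ hi]
    cases hs : μ.school i with
    | none => exact (P i).not_prefers_self (hs ▸ hacc)
    | some s =>
      rw [hs] at hi hacc
      refine not_affordable_of_mem_daStep haff (hC Q) henvy subset_rfl
        (fun i s => not_affordable_of_mem_daRejections haff (hC Q) henvy)
        (mem_daStep_of_prefers hi hacc) (hs ▸ haff i)
  have hin : ∀ i ∈ T, μ.school i = δ.school i := by
    intro i hi
    have hupd : Function.update Q i ((P i).truncate (δ.school i)) =
        truncatedProfile δ P (T.erase i) := by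
      funext j
      by_cases hj : j = i
      · subst hj; simp [truncatedProfile]
      · simp [hQ, truncatedProfile, hj]
    have := hSP Q i ((P i).truncate (δ.school i))
    rw [hupd, ih _ (Finset.erase_ssubset hi) i] at this
    have hQi : Q i = P i := by simp [hQ, truncatedProfile, hi]
    rw [hQi] at this
    exact this.resolve_left (hdom i)
  have hout : ∀ i, μ.school i = none ∨ μ.school i = δ.school i := by
    intro i
    by_cases hi : i ∈ T
    · exact .inr (hin i hi)
    · refine or_iff_not_imp_left.2 fun hne => ?_
      have := hIR Q i
      simp only [hQ, truncatedProfile, if_neg hi] at this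
      exact (Preference.weaklyPrefers_of_truncate this hne).resolve_left (hdom i)
  intro i
  refine (hout i).elim (fun hnone => ?_) id
  by_contra hne
  rw [hnone] at hne
  obtain ⟨s, hs⟩ := Option.ne_none_iff_exists'.1 (Ne.symm hne)
  -- The school `s` has a free seat under `μ`, so `i` could afford it.
  have hlt : (μ.admitted s).card < E.capacity s := by
    refine (Finset.card_lt_card (t := δ.admitted s) ?_).trans_le (δ.card_le_capacity s)
    rw [Finset.ssubset_iff_of_subset]
    · refine ⟨i, AugmentedMatching.mem_admitted.2 hs, ?_⟩
      rw [AugmentedMatching.mem_admitted, hnone]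
      exact nofun
    · intro j hj
      rw [AugmentedMatching.mem_admitted] at hj ⊢
      rcases hout j with h | h
      · rw [hj] at h; cases h
      · rw [← h, hj]
  refine henvy i s ?_ (.inr hs.symm) (AugmentedMatching.some_mem_affordable_of_card_lt hlt i)
  rw [hnone]
  exact deferredAcceptance_school_prefers_none hs

end Market

namespace Market

open scoped Classical

variable {I S M : Type*} [Fintype I] [Fintype M] {E : Market I S M}

/-! ### Cutoffs -/

namespace AugmentedMatching

variable {μ : E.AugmentedMatching} {s : S} {i : I} {m : M}

theorem mem_reservedAt :
    i ∈ μ.reservedAt s m ↔ E.type i = m ∧ μ.assign i = some (s, SeatType.reservedSeat) := by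
  simp [reservedAt]

theorem mem_openAt : i ∈ μ.openAt s ↔ μ.assign i = some (s, SeatType.openSeat) := by
  simp [openAt]

theorem reservedAt_subset_admitted : μ.reservedAt s m ⊆ μ.admitted s := by
  intro i hi
  simp only [admitted, Finset.mem_filter, Finset.mem_univ, true_and]
  exact ⟨_, (mem_reservedAt.1 hi).2⟩

theorem openAt_subset_admitted : μ.openAt s ⊆ μ.admitted s := by
  intro i hi
  simp only [admitted, Finset.mem_filter, Finset.mem_univ, true_and]
  exact ⟨_, mem_openAt.1 hi⟩

theorem mem_openAt_or_mem_reservedAt (hi : i ∈ μ.admitted s) :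
    i ∈ μ.openAt s ∨ i ∈ μ.reservedAt s (E.type i) := by
  simp only [admitted, Finset.mem_filter, Finset.mem_univ, true_and] at hi
  obtain ⟨_ | _, ht⟩ := hi
  exacts [.inr (mem_reservedAt.2 ⟨rfl, ht⟩), .inl (mem_openAt.2 ht)]

theorem not_mem_openAt_of_mem_reservedAt (hi : i ∈ μ.reservedAt s m) : i ∉ μ.openAt s := by
  rw [mem_openAt, (mem_reservedAt.1 hi).2]
  exact nofun

theorem reservedCutoff_le (hi : i ∈ μ.reservedAt s m) :
    μ.reservedCutoff s m ≤ E.score i s := by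
  have hpos : E.reserve s m ≠ 0 :=
    ((Finset.card_pos.2 ⟨i, hi⟩).trans_le (μ.card_le_reserve s m)).ne'
  rw [reservedCutoff, if_neg hpos]
  split_ifs
  exacts [Finset.inf_le hi, zero_le]

theorem openCutoff_le (hi : i ∈ μ.openAt s) : μ.openCutoff s ≤ E.score i s := by
  rw [openCutoff]
  split_ifs
  exacts [Finset.inf_le hi, zero_le]

theorem some_mem_affordable :
    some s ∈ μ.affordable i ↔ μ.reservedCutoff s (E.type i) ≤ E.score i s ∨
      μ.openCutoff s ≤ E.score i s := by
  simp [affordable]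

/-- A student below a cutoff for reserved seats meets a filled reserve quota. -/
theorem card_reservedAt_eq (h : ¬ μ.reservedCutoff s m ≤ E.score i s) :
    (μ.reservedAt s m).card = E.reserve s m := by
  by_contra hne
  by_cases h0 : E.reserve s m = 0
  · have := μ.card_le_reserve s m
    change (μ.reservedAt s m).card ≤ _ at this
    omega
  · exact h (by simp [reservedCutoff, h0, hne])

theorem score_lt_of_mem_reservedAt (h : ¬ μ.reservedCutoff s m ≤ E.score i s) {j : I}
    (hj : j ∈ μ.reservedAt s m) : E.score i s < E.score j s := by
  exact_mod_cast (not_le.1 h).trans_le (reservedCutoff_le hj)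

/-- In an RO-verifiable matching, those admitted students whose scores reach the cutoff for the
reserved seats of their type have reserved seats. -/
theorem ROVerifiable.mem_reservedAt_iff {P : I → Preference S} (h : μ.ROVerifiable P)
    (hi : i ∈ μ.admitted s) :
    i ∈ μ.reservedAt s (E.type i) ↔ μ.reservedCutoff s (E.type i) ≤ E.score i s := by
  refine ⟨reservedCutoff_le, fun hc => ?_⟩
  simp only [admitted, Finset.mem_filter, Finset.mem_univ, true_and] at hi
  obtain ⟨t, ht⟩ := hi
  have := h.2 i s t ht
  rw [if_pos hc] at this
  exact mem_reservedAt.2 ⟨rfl, this ▸ ht⟩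

theorem ORVerifiable.mem_openAt_iff {P : I → Preference S} (h : μ.ORVerifiable P)
    (hi : i ∈ μ.admitted s) : i ∈ μ.openAt s ↔ μ.openCutoff s ≤ E.score i s := by
  refine ⟨openCutoff_le, fun hc => ?_⟩
  simp only [admitted, Finset.mem_filter, Finset.mem_univ, true_and] at hi
  obtain ⟨t, ht⟩ := hi
  have := h.2 i s t ht
  rw [if_pos hc] at this
  exact mem_openAt.2 (this ▸ ht)

end AugmentedMatching

open AugmentedMatching

/-! ### Students with the highest priority -/

variable {s : S} {i j : I} {m : M} {k : ℕ} {A : Finset I}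

theorem mem_top :
    i ∈ E.top s k A ↔ i ∈ A ∧ (A.filter fun j => E.score i s < E.score j s).card < k := by
  simp [top]

theorem le_card_of_not_mem_top (hi : i ∈ A) (h : i ∉ E.top s k A) :
    k ≤ (A.filter fun j => E.score i s < E.score j s).card :=
  not_lt.1 fun h' => h (mem_top.2 ⟨hi, h'⟩)

theorem mem_top_of_score_le (hj : j ∈ E.top s k A) (hi : i ∈ A)
    (h : E.score j s ≤ E.score i s) : i ∈ E.top s k A := by
  rw [mem_top] at hj ⊢
  refine ⟨hi, lt_of_le_of_lt (Finset.card_le_card fun l hl => ?_) hj.2⟩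
  rw [Finset.mem_filter] at hl ⊢
  exact ⟨hl.1, h.trans_lt hl.2⟩

theorem mem_reservedPick : i ∈ E.reservedPick s A ↔
    i ∈ E.top s (E.reserve s (E.type i)) (A.filter fun j => E.type j = E.type i) := by
  simp only [reservedPick, Finset.mem_biUnion, Finset.mem_univ, true_and]
  refine ⟨?_, fun h => ⟨_, h⟩⟩
  rintro ⟨m, hm⟩
  obtain rfl := (Finset.mem_filter.1 (mem_top.1 hm).1).2
  exact hm

theorem reservedPick_subset : E.reservedPick s A ⊆ A := fun _ hi =>
  Finset.mem_of_mem_filter _ (mem_top.1 (mem_reservedPick.1 hi)).1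

theorem card_filter_reservedPick_le (m : M) :
    ((E.reservedPick s A).filter fun i => E.type i = m).card ≤ E.reserve s m := by
  refine (Finset.card_le_card fun i hi => ?_).trans
    (E.card_top_le s _ (A.filter fun j => E.type j = m))
  obtain ⟨hpick, rfl⟩ := Finset.mem_filter.1 hi
  exact mem_reservedPick.1 hpick

omit [Fintype I] in
theorem seating_eq_reservedSeat {R O : Finset I} :
    seating R O i = some SeatType.reservedSeat ↔ i ∈ R := by
  unfold seating
  split_ifs <;> simp [*]

omit [Fintype I] in
theorem seating_eq_none_iff {R O : Finset I} : seating R O i = none ↔ i ∉ R ∧ i ∉ O := by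
  unfold seating
  split_ifs <;> simp [*]

/-- Of two sets of students, the larger one has more students of some type. -/
theorem exists_card_filter_type_lt {B R : Finset I} (h : B.card < R.card) :
    ∃ m, (B.filter fun i => E.type i = m).card < (R.filter fun i => E.type i = m).card := by
  rw [Finset.card_eq_sum_card_fiberwise (f := E.type) (t := Finset.univ) (by simp [Set.MapsTo]),
    Finset.card_eq_sum_card_fiberwise (s := R) (f := E.type) (t := Finset.univ)
      (by simp [Set.MapsTo])] at h
  obtain ⟨m, -, hm⟩ := Finset.exists_lt_of_sum_lt h
  exact ⟨m, hm⟩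

/-- A student with a reserved seat remains among the highest-ranked students of her type, up to
the reserve quota, in any set whose members of her type with better scores have reserved seats. -/
theorem mem_reservedPick_of_forall {μ : E.AugmentedMatching} (hiA : i ∈ A)
    (hi : i ∈ μ.reservedAt s (E.type i))
    (h : ∀ j ∈ A, E.type j = E.type i → E.score i s < E.score j s →
      j ∈ μ.reservedAt s (E.type i)) : i ∈ E.reservedPick s A := by
  rw [mem_reservedPick, mem_top]
  refine ⟨by simp [hiA], (Finset.card_lt_card ?_).trans_le (μ.card_le_reserve s (E.type i))⟩
  change _ ⊂ μ.reservedAt s (E.type i)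
  rw [Finset.ssubset_iff_of_subset]
  · exact ⟨i, hi, by simp⟩
  · intro j hj
    simp only [Finset.mem_filter] at hj
    exact h j hj.1.1 hj.1.2 hj.2

/-! ### Reserved seats first -/

section RO

variable {μ : E.AugmentedMatching} {P : I → Preference S}

/-- SimRO gives reserved seats to all applicants who have them under an RO-verifiable matching, if
the other applicants are admitted to `s` under it or cannot afford `s`. -/
theorem mem_reservedPick_of_roVerifiable (hμ : μ.ROVerifiable P)
    (hA : ∀ j ∈ A, μ.school j = some s ∨ some s ∉ μ.affordable j) (hiA : i ∈ A)
    (hi : i ∈ μ.reservedAt s (E.type i)) : i ∈ E.reservedPick s A := by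
  refine mem_reservedPick_of_forall hiA hi fun j hj hji hlt => ?_
  have hcut : μ.reservedCutoff s (E.type j) ≤ E.score j s := by
    rw [hji]
    exact (reservedCutoff_le hi).trans (by exact_mod_cast hlt.le)
  have hjs := (hA j hj).resolve_right fun h => h (some_mem_affordable.2 (.inl hcut))
  exact hji ▸ (hμ.mem_reservedAt_iff (mem_admitted.2 hjs)).2 hcut

/-- From a set of applicants that includes all students admitted to `s` under an RO-verifiable
matching, SimRO gives reserved seats only to those of them who have reserved seats already. -/
theorem mem_reservedAt_of_mem_reservedPick (hμ : μ.ROVerifiable P) (hDA : μ.admitted s ⊆ A)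
    (hi : i ∈ μ.admitted s) (hpick : i ∈ E.reservedPick s A) :
    i ∈ μ.reservedAt s (E.type i) := by
  rw [hμ.mem_reservedAt_iff hi]
  by_contra hcut
  refine (mem_top.1 (mem_reservedPick.1 hpick)).2.not_ge ?_
  rw [← card_reservedAt_eq hcut]
  refine Finset.card_le_card fun j hj => ?_
  simp only [Finset.mem_filter]
  exact ⟨⟨hDA (reservedAt_subset_admitted hj), (mem_reservedAt.1 hj).1⟩,
    score_lt_of_mem_reservedAt hcut hj⟩

/-- If the applicants are students who are admitted to `s` under `μ` or cannot afford `s`, then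
SimRO rejects no student with an open seat under `μ`. -/
theorem mem_reservedPick_or_mem_openPick
    (hA : ∀ j ∈ A, μ.school j = some s ∨ some s ∉ μ.affordable j) (hiA : i ∈ A)
    (hi : i ∈ μ.openAt s) :
    i ∈ E.reservedPick s A ∨
      i ∈ E.openPick s (E.reservedPick s A) (A \ E.reservedPick s A) := by
  by_contra! h
  obtain ⟨hiR, hiO⟩ := h
  set R := E.reservedPick s A with hR
  -- The competitors for open seats who outrank `i`; all of them are admitted under `μ`.
  set T := (A \ R).filter fun j => E.score i s < E.score j s with hT
  have hTcard : E.capacity s - R.card ≤ T.card :=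
    le_card_of_not_mem_top (by simp [hiA, hiR]) hiO
  have hiT : i ∉ T := by simp [hT]
  have hTsub : insert i T ⊆ μ.admitted s := by
    intro j hj
    rcases Finset.mem_insert.1 hj with rfl | hj
    · exact openAt_subset_admitted hi
    · simp only [hT, Finset.mem_filter, Finset.mem_sdiff] at hj
      refine mem_admitted.2 ((hA j hj.1.1).resolve_right fun h =>
        h (some_mem_affordable.2 (.inr ((openCutoff_le hi).trans ?_))))
      exact_mod_cast hj.2.le
  have hTA : ∀ j ∈ insert i T, j ∈ A ∧ j ∉ R := by
    intro j hj
    rcases Finset.mem_insert.1 hj with rfl | hj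
    · exact ⟨hiA, hiR⟩
    · exact Finset.mem_sdiff.1 (Finset.mem_of_mem_filter _ hj)
  -- So besides `i` and her competitors, `μ` admits fewer students than SimRO gives reserved seats.
  have hlt : (μ.admitted s \ insert i T).card < R.card := by
    have h1 : (μ.admitted s).card ≤ E.capacity s := μ.card_le_capacity s
    have h2 := Finset.card_le_card hTsub
    rw [Finset.card_sdiff_of_subset hTsub]
    rw [Finset.card_insert_of_notMem hiT] at h2 ⊢
    omega
  obtain ⟨m, hm⟩ := exists_card_filter_type_lt (E := E) hlt
  -- Hence someone who could not afford `s` has a reserved seat for type `m` now ...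
  obtain ⟨j, hj, hjD⟩ : ∃ j ∈ R.filter fun i => E.type i = m, j ∉ μ.admitted s := by
    by_contra! hsub
    refine hm.not_ge (Finset.card_le_card fun j hj => ?_)
    obtain ⟨hjR, hjm⟩ := Finset.mem_filter.1 hj
    exact Finset.mem_filter.2 ⟨Finset.mem_sdiff.2
      ⟨hsub j hj, fun h => (hTA j h).2 hjR⟩, hjm⟩
  obtain ⟨hjR, rfl⟩ := Finset.mem_filter.1 hj
  have hjcut : ¬ μ.reservedCutoff s (E.type j) ≤ E.score j s := fun h =>
    ((hA j (reservedPick_subset hjR)).resolve_left (mem_admitted.not.1 hjD))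
      (some_mem_affordable.2 (.inl h))
  -- ... and someone with such a seat under `μ` has none, although she outranks that student.
  obtain ⟨l, hl, hlT⟩ : ∃ l ∈ μ.reservedAt s (E.type j), l ∈ insert i T := by
    by_contra! hdisj
    refine (hm.trans_le (card_filter_reservedPick_le (E.type j))).not_ge ?_
    rw [← card_reservedAt_eq hjcut]
    refine Finset.card_le_card fun l hl => Finset.mem_filter.2 ⟨Finset.mem_sdiff.2
      ⟨reservedAt_subset_admitted hl, hdisj l hl⟩, (mem_reservedAt.1 hl).1⟩
  obtain ⟨hlA, hlR⟩ := hTA l hlT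
  refine hlR ?_
  have hlj := (mem_reservedAt.1 hl).1
  rw [hR, mem_reservedPick, hlj]
  exact mem_top_of_score_le (mem_reservedPick.1 hjR) (by simp [hlA, hlj])
    (score_lt_of_mem_reservedAt hjcut hl).le

theorem respects_simROChoice (hμ : μ.ROVerifiable P) : Respects E.simROChoice μ := by
  intro s A hA i hiA his hnone
  change seating _ _ i = none at hnone
  rw [seating_eq_none_iff] at hnone
  rcases mem_openAt_or_mem_reservedAt (mem_admitted.2 his) with hi | hi
  · exact (mem_reservedPick_or_mem_openPick hA hiA hi).elim hnone.1 hnone.2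
  · exact hnone.1 (mem_reservedPick_of_roVerifiable hμ hA hiA hi)

end RO

/-! ### Open seats first -/

section OR

variable {μ : E.AugmentedMatching} {P : I → Preference S}

noncomputable instance : Fintype SeatType :=
  ⟨{.reservedSeat, .openSeat}, by rintro (_ | _) <;> simp⟩

theorem card_seatType : Fintype.card SeatType = 2 := by
  simp [Fintype.card, Finset.univ, Fintype.elems]

theorem subset_simORStep (X : Finset (I × SeatType)) : X ⊆ E.simORStep s A X :=
  Finset.subset_union_left.trans Finset.subset_union_left

theorem mem_simORStep_openSeat {X : Finset (I × SeatType)} :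
    (i, SeatType.openSeat) ∈ E.simORStep s A X ↔ (i, SeatType.openSeat) ∈ X ∨
      i ∈ openApplicants A X ∧
        E.simFlex s (openApplicants A X) (reservedApplicants A X) i = none := by
  simp [simORStep]

theorem mem_simORStep_reservedSeat {X : Finset (I × SeatType)} :
    (i, SeatType.reservedSeat) ∈ E.simORStep s A X ↔ (i, SeatType.reservedSeat) ∈ X ∨
      i ∈ reservedApplicants A X ∧
        E.simFlex s (openApplicants A X) (reservedApplicants A X) i = none := by
  simp [simORStep]

omit [Fintype I] in
theorem mem_reservedApplicants {X : Finset (I × SeatType)} : i ∈ reservedApplicants A X ↔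
    i ∈ A ∧ (i, SeatType.openSeat) ∈ X ∧ (i, SeatType.reservedSeat) ∉ X := by
  simp [reservedApplicants]

omit [Fintype I] in
theorem mem_openApplicants {X : Finset (I × SeatType)} : i ∈ openApplicants A X ↔
    i ∈ A ∧ (i, SeatType.openSeat) ∉ X := by
  simp [openApplicants]

theorem simORStep_simORRejections :
    E.simORStep s A (E.simORRejections s A) = E.simORRejections s A := by
  have h := iterate_card_fixed (E.simORStep s A) subset_simORStep
  rwa [Fintype.card_prod, card_seatType, mul_comm] at h

/-- The rejections `X` by the two subschools of `s` respect `μ`: nobody has lost an open seat that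
she has under `μ`, and nobody admitted to `s` under `μ` has been rejected by both subschools. -/
def RejectionsRespect (μ : E.AugmentedMatching) (s : S) (X : Finset (I × SeatType)) : Prop :=
  ∀ i, ((i, SeatType.openSeat) ∈ X → i ∉ μ.openAt s) ∧
    ((i, SeatType.reservedSeat) ∈ X → i ∉ μ.admitted s)

theorem rejectionsRespect_simORStep (hμ : μ.ORVerifiable P)
    (hA : ∀ j ∈ A, μ.school j = some s ∨ some s ∉ μ.affordable j)
    {X : Finset (I × SeatType)} (hX : RejectionsRespect μ s X) :
    RejectionsRespect μ s (E.simORStep s A X) := by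
  intro i
  rw [mem_simORStep_openSeat, mem_simORStep_reservedSeat]
  constructor
  · rintro (h | ⟨hiA, hnone⟩)
    · exact (hX i).1 h
    intro hi
    rw [simFlex, seating_eq_none_iff] at hnone
    set R := E.reservedPick s (reservedApplicants A X) with hR
    -- The applicants to the open subschool who outrank `i` have open seats under `μ`.
    have hle := le_card_of_not_mem_top hiA hnone.2
    have hlt : ((openApplicants A X).filter fun j => E.score i s < E.score j s).card <
        (μ.openAt s).card := by
      refine Finset.card_lt_card ((Finset.ssubset_iff_of_subset ?_).2 ⟨i, hi, by simp⟩)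
      intro j hj
      obtain ⟨hj, hij⟩ := Finset.mem_filter.1 hj
      have hcut : μ.openCutoff s ≤ E.score j s :=
        (openCutoff_le hi).trans (by exact_mod_cast hij.le)
      have hjs := (hA j (mem_openApplicants.1 hj).1).resolve_right fun h =>
        h (some_mem_affordable.2 (.inr hcut))
      exact (hμ.mem_openAt_iff (mem_admitted.2 hjs)).2 hcut
    -- So `μ` has fewer students in reserved seats than are picked now, for some type `m`.
    have hlt' : (μ.admitted s \ μ.openAt s).card < R.card := by
      have h1 : (μ.admitted s).card ≤ E.capacity s := μ.card_le_capacity s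
      have h2 := Finset.card_le_card (openAt_subset_admitted (μ := μ) (s := s))
      rw [Finset.card_sdiff_of_subset openAt_subset_admitted]
      omega
    obtain ⟨m, hm⟩ := exists_card_filter_type_lt (E := E) hlt'
    have hsub : μ.reservedAt s m ⊆
        (μ.admitted s \ μ.openAt s).filter fun i => E.type i = m := fun l hl =>
      Finset.mem_filter.2 ⟨Finset.mem_sdiff.2 ⟨reservedAt_subset_admitted hl,
        not_mem_openAt_of_mem_reservedAt hl⟩, (mem_reservedAt.1 hl).1⟩
    have hm' := (Finset.card_le_card hsub).trans_lt hm
    have hne : (μ.reservedAt s m).card ≠ E.reserve s m :=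
      (hm'.trans_le (card_filter_reservedPick_le m)).ne
    -- The quota for `m` is not exhausted, so all students of type `m` can afford `s`.
    refine hm.not_ge (Finset.card_le_card fun j hj => ?_)
    obtain ⟨hjR, rfl⟩ := Finset.mem_filter.1 hj
    obtain ⟨hjA, hjo, -⟩ := mem_reservedApplicants.1 (reservedPick_subset hjR)
    have hjs := (hA j hjA).resolve_right fun h => hne (card_reservedAt_eq (i := j) fun hc =>
      h (some_mem_affordable.2 (.inl hc)))
    exact Finset.mem_filter.2 ⟨Finset.mem_sdiff.2 ⟨mem_admitted.2 hjs, (hX j).1 hjo⟩, rfl⟩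
  · rintro (h | ⟨hiA, hnone⟩)
    · exact (hX i).2 h
    intro hi
    rw [simFlex, seating_eq_none_iff] at hnone
    have hres : ∀ j ∈ reservedApplicants A X, j ∈ μ.admitted s →
        j ∈ μ.reservedAt s (E.type j) := fun j hj hjs =>
      (mem_openAt_or_mem_reservedAt hjs).resolve_left ((hX j).1 (mem_reservedApplicants.1 hj).2.1)
    refine hnone.1 (mem_reservedPick_of_forall hiA (hres i hiA hi) fun j hj hji hij => ?_)
    have hcut : μ.reservedCutoff s (E.type j) ≤ E.score j s := by
      rw [hji]
      exact (reservedCutoff_le (hres i hiA hi)).trans (by exact_mod_cast hij.le)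
    have hjs := (hA j (mem_reservedApplicants.1 hj).1).resolve_right fun h =>
      h (some_mem_affordable.2 (.inl hcut))
    exact hji ▸ hres j hj (mem_admitted.2 hjs)

theorem rejectionsRespect_simORRejections (hμ : μ.ORVerifiable P)
    (hA : ∀ j ∈ A, μ.school j = some s ∨ some s ∉ μ.affordable j) :
    RejectionsRespect μ s (E.simORRejections s A) := by
  unfold simORRejections
  generalize 2 * Fintype.card I = n
  induction n with
  | zero => simp [RejectionsRespect]
  | succ n ih =>
    rw [Function.iterate_succ_apply']
    exact rejectionsRespect_simORStep hμ hA ih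

theorem respects_simORChoice (hμ : μ.ORVerifiable P) : Respects E.simORChoice μ := by
  intro s A hA i hiA his hnone
  change E.simFlex s _ _ i = none at hnone
  have hX := rejectionsRespect_simORRejections hμ hA i
  have hr : (i, SeatType.reservedSeat) ∉ E.simORRejections s A := fun h =>
    hX.2 h (mem_admitted.2 his)
  by_cases ho : (i, SeatType.openSeat) ∈ E.simORRejections s A
  · refine hr ?_
    rw [← simORStep_simORRejections, mem_simORStep_reservedSeat]
    exact .inr ⟨mem_reservedApplicants.2 ⟨hiA, ho, hr⟩, hnone⟩
  · refine ho ?_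
    rw [← simORStep_simORRejections, mem_simORStep_openSeat]
    exact .inr ⟨mem_openApplicants.2 ⟨hiA, ho⟩, hnone⟩

/-- SimOR gives no reserved seat to a student who has an open seat under `μ`. -/
theorem not_mem_openAt_of_simORChoice (hμ : μ.ORVerifiable P)
    (hA : ∀ j ∈ A, μ.school j = some s ∨ some s ∉ μ.affordable j)
    (hi : (E.simORChoice s).seat A i = some SeatType.reservedSeat) : i ∉ μ.openAt s := by
  change E.simFlex s _ _ i = _ at hi
  rw [simFlex, seating_eq_reservedSeat] at hi
  exact (rejectionsRespect_simORRejections hμ hA i).1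
    (mem_reservedApplicants.1 (reservedPick_subset hi)).2.1

end OR

/-! ### Comparison with SimRO and SimOR -/

variable [Fintype S] {v : OfferConvention} {C : ∀ s, E.ChoiceRule s}

/-- A strategy-proof mechanism whose outcomes are respected by the choice rules yields the schools
of deferred acceptance. -/
theorem school_eq_deferredAcceptance {ψ : E.DirectMechanism} (hIR : ψ.IndividuallyRational)
    (hSP : ψ.StrategyProof) (hbest : ∀ P, (ψ P).BestAffordable P)
    (hC : ∀ P, Respects C (ψ P)) (P : I → Preference S) :
    (ψ P).school = (deferredAcceptance v E C P).school := by
  have h := school_truncatedProfile (v := v) hIR hSP hbest hC P Finset.univ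
  have hP : truncatedProfile (deferredAcceptance v E C P) P Finset.univ = P := by
    funext i
    simp [truncatedProfile]
  rw [hP] at h
  exact funext h

/-- In the last round of deferred acceptance, all applicants of `s` are students who are admitted
to `s` under `μ` or cannot afford it. -/
theorem applicants_daRejections_school_or_not_affordable {μ : E.AugmentedMatching}
    {P : I → Preference S} (hbest : μ.BestAffordable P) (hC : Respects C μ) {s : S} {j : I}
    (hj : j ∈ applicants v P (daRejections v E C P) s) :
    μ.school j = some s ∨ some s ∉ μ.affordable j := by
  have haff := fun i => (hbest i).1
  have henvy : ∀ i s, (P i).Prefers (some s) (μ.school i) →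
      (P i).WeaklyPrefers (some s) ((deferredAcceptance v E C P).school i) →
      some s ∉ μ.affordable i := fun i s h _ h' => ((hbest i).2 _ h').not_prefers h
  exact applicants_school_or_not_affordable haff henvy subset_rfl
    (fun i s => not_affordable_of_mem_daRejections haff hC henvy) hj

theorem deferredAcceptance_assign_eq_some_iff {P : I → Preference S} {i : I} {s : S}
    {t : SeatType} : (deferredAcceptance v E C P).assign i = some (s, t) ↔
      target P (daRejections v E C P) i = some s ∧
        (C s).seat (applicants v P (daRejections v E C P) s) i = some t := by
  simp only [deferredAcceptance, Option.bind_eq_some_iff, Option.map_eq_some_iff, Prod.mk.injEq]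
  constructor
  · rintro ⟨s', hs', t', ht', rfl, rfl⟩
    exact ⟨hs', ht'⟩
  · rintro ⟨hs, ht⟩
    exact ⟨s, hs, t, ht, rfl, rfl⟩

omit [Fintype S] in
theorem AugmentedMatching.school_eq_some_of_assign {μ : E.AugmentedMatching} {i : I} {s : S}
    {t : SeatType} (h : μ.assign i = some (s, t)) : μ.school i = some s := by
  simp [school, h]

omit [Fintype S] in
theorem AugmentedMatching.ext_of_reserved {μ ν : E.AugmentedMatching} (hsch : μ.school = ν.school)
    (h : ∀ i s, μ.school i = some s → (μ.assign i = some (s, SeatType.reservedSeat) ↔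
      ν.assign i = some (s, SeatType.reservedSeat))) : μ = ν := by
  refine AugmentedMatching.ext (funext fun i => ?_)
  have hi := congrFun hsch i
  have h := h i
  simp only [school] at hi h
  rcases hμ : μ.assign i with _ | ⟨s, _ | _⟩ <;> rcases hν : ν.assign i with _ | ⟨s', _ | _⟩ <;>
    simp_all

/-- An individually rational, strategy-proof and RO-verifiable mechanism is SimRO. -/
theorem DirectMechanism.ROVerifiable.eq_simRO {ψ : E.DirectMechanism}
    (hIR : ψ.IndividuallyRational) (hSP : ψ.StrategyProof) (hRO : ψ.ROVerifiable)
    (P : I → Preference S) : ψ P = simRO v E P := by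
  have hsch : (ψ P).school = (simRO v E P).school :=
    school_eq_deferredAcceptance hIR hSP (fun P => (hRO P).1)
      (fun P => respects_simROChoice (hRO P)) P
  refine AugmentedMatching.ext_of_reserved hsch fun i s his => ?_
  set A := applicants v P (daRejections v E E.simROChoice P) s with hAdef
  have hA : ∀ j ∈ A, (ψ P).school j = some s ∨ some s ∉ (ψ P).affordable j := fun j =>
    applicants_daRejections_school_or_not_affordable (hRO P).1 (respects_simROChoice (hRO P))
  have htarget : ∀ j, (ψ P).school j = some s →
      target P (daRejections v E E.simROChoice P) j = some s := fun j hj =>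
    (deferredAcceptance_school_eq_some_iff.1 ((congrFun hsch j).symm.trans hj)).1
  have hDA : (ψ P).admitted s ⊆ A := fun j hj =>
    mem_applicants_of_target (htarget j (mem_admitted.1 hj))
  have hseat : (simRO v E P).assign i = some (s, SeatType.reservedSeat) ↔
      i ∈ E.reservedPick s A := by
    rw [simRO, deferredAcceptance_assign_eq_some_iff, and_iff_right (htarget i his)]
    exact seating_eq_reservedSeat
  have hres : (ψ P).assign i = some (s, SeatType.reservedSeat) ↔
      i ∈ (ψ P).reservedAt s (E.type i) := by
    rw [mem_reservedAt, and_iff_right rfl]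
  have hi := mem_admitted.2 his
  rw [hseat, hres]
  exact ⟨mem_reservedPick_of_roVerifiable (hRO P) hA (hDA hi),
    mem_reservedAt_of_mem_reservedPick (hRO P) hDA hi⟩

/-- An individually rational, strategy-proof and OR-verifiable mechanism yields the schools of
SimOR, and in reserved seats at least the students who have them under SimOR. -/
theorem DirectMechanism.ORVerifiable.school_eq_simOR {ψ : E.DirectMechanism}
    (hIR : ψ.IndividuallyRational) (hSP : ψ.StrategyProof) (hOR : ψ.ORVerifiable)
    (P : I → Preference S) : (ψ P).school = (simOR v E P).school ∧
      (simOR v E P).reservedStudents ⊆ (ψ P).reservedStudents := by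
  have hsch : (ψ P).school = (simOR v E P).school :=
    school_eq_deferredAcceptance hIR hSP (fun P => (hOR P).1)
      (fun P => respects_simORChoice (hOR P)) P
  refine ⟨hsch, ?_⟩
  rintro i ⟨s, hs⟩
  have his : (ψ P).school i = some s :=
    (congrFun hsch i).trans (school_eq_some_of_assign hs)
  rw [simOR, deferredAcceptance_assign_eq_some_iff] at hs
  have hopen := not_mem_openAt_of_simORChoice (hOR P) (fun j =>
    applicants_daRejections_school_or_not_affordable (hOR P).1
      (respects_simORChoice (hOR P))) hs.2
  have := (mem_openAt_or_mem_reservedAt (mem_admitted.2 his)).resolve_left hopen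
  exact ⟨s, (mem_reservedAt.1 this).2⟩

end Market

theorem theorem2 {I S M : Type*} [Fintype I] [Fintype S] [Fintype M]
    (E : Market I S M) (v : Market.OfferConvention) (ψ : E.DirectMechanism)
    (hIR : ψ.IndividuallyRational) (hSP : ψ.StrategyProof) :
    (ψ.ROVerifiable → ∀ P, ψ P = Market.simRO v E P) ∧
    (ψ.ORVerifiable → ∀ P,
      (ψ P).school = (Market.simOR v E P).school ∧
      (Market.simOR v E P).reservedStudents ⊆ (ψ P).reservedStudents) :=
  ⟨fun h => h.eq_simRO hIR hSP, fun h => h.school_eq_simOR hIR hSP⟩
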